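/- Let $\Gamma=(V,E)$ be a simple locally finite graph, let $d(v)$ denote the degree of $v\in V$, and let $L$ be the normalized Laplacian of $\Gamma$, i.e. the bounded operator on $\ell^2(V)$ (complex-valued square-summable functions on $V$) given by $$Lf(v)=f(v)-\sum_{w\sim v}\frac{1}{\sqrt{d(v)d(w)}}\,f(w).$$ For $d\in\mathbb N$ let $\mathbb B^{(d)}$ be the set of bounded operators on $\ell^2(V)$ whose matrix with respect to the standard orthonormal basis of $\ell^2(V)$ (the characteristic functions of the vertices) has at most $d$ non-zero entries in each row and in each column. The graph $\Gamma$ is called approximately uniformly locally finite (AULF) if $L$ lies in the operator norm closure of $\bigcup_{d\in\mathbb N}\mathbb B^{(d)}$. Proposition 2.2 (complete bipartite graphs). Let $(k_n)_{n\in\mathbb N}$ and $(l_n)_{n\in\mathbb N}$ be sequences of positive integers with $k_n\le l_n$ for all $n$, and let $\Gamma=\bigsqcup_{n\in\mathbb N}K_{k_n,l_n}$ be the disjoint union of the complete bipartite graphs $K_{k_n,l_n}$. If the sequence $l_n/k_n$, $n\in\mathbb N$, is bounded then $\Gamma$ is AULF; otherwise $\Gamma$ is not AULF. -/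

import Mathlib

namespace SimpleGraph

section Operators

variable {V : Type*} (G : SimpleGraph V) [G.LocallyFinite]

/-- The function `A f (v) = ∑_{w ∼ v} f(w) / √(d(v) d(w))`, the normalized adjacency operator
`D^{-1/2} 𝒜 D^{-1/2}` applied to a function `f` on the vertices. -/
noncomputable def normAdjFun (f : V → ℂ) (v : V) : ℂ :=
  ∑ w ∈ G.neighborFinset v, ((1 / √((G.degree v : ℝ) * (G.degree w : ℝ)) : ℝ) : ℂ) * f w

theorem norm_normAdjFun_sq_le (f : V → ℂ) (v : V) :
    ‖G.normAdjFun f v‖ ^ 2 ≤ ∑ w ∈ G.neighborFinset v, ‖f w‖ ^ 2 / (G.degree w : ℝ) := by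
  set N := G.neighborFinset v with hN
  have h1 : ‖G.normAdjFun f v‖ ≤
      ∑ w ∈ N, (1 / √(G.degree v : ℝ)) * (‖f w‖ / √(G.degree w : ℝ)) := by
    refine (norm_sum_le _ _).trans (le_of_eq (Finset.sum_congr rfl fun w _ => ?_))
    rw [norm_mul, Complex.norm_real, Real.norm_of_nonneg (by positivity),
      Real.sqrt_mul (by positivity), one_div, mul_inv]
    ring
  have h2 : ∑ w ∈ N, (1 / √(G.degree v : ℝ)) ^ 2 ≤ 1 := by
    rw [Finset.sum_const, hN, card_neighborFinset_eq_degree, nsmul_eq_mul, div_pow, one_pow,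
      Real.sq_sqrt (by positivity), mul_one_div]
    exact div_self_le_one _
  calc ‖G.normAdjFun f v‖ ^ 2
      ≤ (∑ w ∈ N, (1 / √(G.degree v : ℝ)) * (‖f w‖ / √(G.degree w : ℝ))) ^ 2 := by gcongr
    _ ≤ (∑ w ∈ N, (1 / √(G.degree v : ℝ)) ^ 2) * ∑ w ∈ N, (‖f w‖ / √(G.degree w : ℝ)) ^ 2 :=
        Finset.sum_mul_sq_le_sq_mul_sq _ _ _
    _ ≤ 1 * ∑ w ∈ N, (‖f w‖ / √(G.degree w : ℝ)) ^ 2 := by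
        gcongr
    _ = ∑ w ∈ N, ‖f w‖ ^ 2 / (G.degree w : ℝ) := by
        rw [one_mul]
        refine Finset.sum_congr rfl fun w _ => ?_
        rw [div_pow, Real.sq_sqrt (by positivity)]

theorem sum_norm_normAdjFun_sq_le (f : lp (fun _ : V => ℂ) 2) (s : Finset V) :
    ∑ v ∈ s, ‖G.normAdjFun f v‖ ^ 2 ≤ ‖f‖ ^ 2 := by
  classical
  set U := s.biUnion fun v => G.neighborFinset v with hU
  have key : ∑ w ∈ U, ‖f w‖ ^ 2 ≤ ‖f‖ ^ 2 := by
    simpa using lp.sum_rpow_le_norm_rpow (p := 2) (by norm_num) f U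
  refine le_trans ?_ key
  calc ∑ v ∈ s, ‖G.normAdjFun f v‖ ^ 2
      ≤ ∑ v ∈ s, ∑ w ∈ G.neighborFinset v, ‖f w‖ ^ 2 / (G.degree w : ℝ) :=
        Finset.sum_le_sum fun v _ => G.norm_normAdjFun_sq_le f v
    _ = ∑ w ∈ U, ∑ _v ∈ s ∩ G.neighborFinset w, ‖f w‖ ^ 2 / (G.degree w : ℝ) := by
        refine Finset.sum_comm' fun v w => ?_
        simp only [hU, Finset.mem_inter, Finset.mem_biUnion, mem_neighborFinset]
        constructor
        · rintro ⟨hv, hvw⟩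
          exact ⟨⟨hv, hvw.symm⟩, v, hv, hvw⟩
        · rintro ⟨⟨hv, hwv⟩, -⟩
          exact ⟨hv, hwv.symm⟩
    _ ≤ ∑ w ∈ U, ‖f w‖ ^ 2 := by
        refine Finset.sum_le_sum fun w _ => ?_
        rw [Finset.sum_const, nsmul_eq_mul]
        have hc : ((s ∩ G.neighborFinset w).card : ℝ) ≤ G.degree w := by
          rw [← card_neighborFinset_eq_degree]
          exact_mod_cast Finset.card_le_card Finset.inter_subset_right
        calc ((s ∩ G.neighborFinset w).card : ℝ) * (‖f w‖ ^ 2 / (G.degree w : ℝ))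
            ≤ (G.degree w : ℝ) * (‖f w‖ ^ 2 / (G.degree w : ℝ)) := by gcongr
          _ = ‖f w‖ ^ 2 * ((G.degree w : ℝ) / (G.degree w : ℝ)) := by ring
          _ ≤ ‖f w‖ ^ 2 * 1 := by gcongr; exact div_self_le_one _
          _ = ‖f w‖ ^ 2 := mul_one _

/-- The normalized adjacency operator `A` as a bounded operator on `ℓ²(V)`. -/
noncomputable def normAdj : lp (fun _ : V => ℂ) 2 →L[ℂ] lp (fun _ : V => ℂ) 2 :=
  LinearMap.mkContinuous
    { toFun := fun f => ⟨G.normAdjFun f, memℓp_gen' (C := ‖f‖ ^ 2) fun s => by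
        simpa using G.sum_norm_normAdjFun_sq_le f s⟩
      map_add' := fun f g => by
        ext v
        change G.normAdjFun _ v = G.normAdjFun f v + G.normAdjFun g v
        simp [normAdjFun, mul_add, Finset.sum_add_distrib]
      map_smul' := fun c f => by
        ext v
        simp [normAdjFun, Finset.mul_sum, mul_left_comm] }
    1 fun f => by
      rw [one_mul]
      refine lp.norm_le_of_forall_sum_le (by norm_num) (norm_nonneg f) fun s => ?_
      simpa using G.sum_norm_normAdjFun_sq_le f s

/-- The normalized Laplacian `L f (v) = f(v) - ∑_{w ∼ v} f(w) / √(d(v) d(w))`, i.e. `L = I - A`,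
as a bounded operator on `ℓ²(V)`. -/
noncomputable def normLaplacian : lp (fun _ : V => ℂ) 2 →L[ℂ] lp (fun _ : V => ℂ) 2 :=
  ContinuousLinearMap.id ℂ _ - G.normAdj

theorem normLaplacian_apply (f : lp (fun _ : V => ℂ) 2) (v : V) :
    G.normLaplacian f v = f v - ∑ w ∈ G.neighborFinset v,
      ((1 / √((G.degree v : ℝ) * (G.degree w : ℝ)) : ℝ) : ℂ) * f w :=
  rfl

end Operators

section SparseOperators

variable {V : Type*}

open Classical in
/-- The entry `T_{vw}` of the matrix of the operator `T` with respect to the standard orthonormal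
basis `δ_v` of `ℓ²(V)`: the `v`-th coordinate of `T δ_w`. -/
noncomputable def matrixEntry (T : lp (fun _ : V => ℂ) 2 →L[ℂ] lp (fun _ : V => ℂ) 2)
    (v w : V) : ℂ :=
  T (lp.single 2 w (1 : ℂ)) v

/-- The set of bounded operators on `ℓ²(V)` whose matrix has at most `d` non-zero entries in each
row and in each column. -/
def sparseOperators (V : Type*) (d : ℕ) :
    Set (lp (fun _ : V => ℂ) 2 →L[ℂ] lp (fun _ : V => ℂ) 2) :=
  {T | (∀ v, {w | matrixEntry T v w ≠ 0}.encard ≤ d) ∧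
    ∀ w, {v | matrixEntry T v w ≠ 0}.encard ≤ d}

/-- A locally finite graph is approximately uniformly locally finite if its normalized Laplacian
lies in the operator norm closure of the union over `d` of the sets `sparseOperators V d`. -/
def IsAULF (G : SimpleGraph V) [G.LocallyFinite] : Prop :=
  G.normLaplacian ∈ closure (⋃ d : ℕ, sparseOperators V d)

end SparseOperators

section DisjointUnion

variable {ι : Type*} {W : ι → Type*}

/-- The disjoint union of a family of graphs: `⟨i, a⟩` and `⟨j, b⟩` are adjacent iff `i = j` and
`a`, `b` are adjacent in the `i`-th graph. -/
def disjointUnion (H : ∀ i, SimpleGraph (W i)) : SimpleGraph (Σ i, W i) where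
  Adj x y := ∃ (i : ι) (a b : W i), x = ⟨i, a⟩ ∧ y = ⟨i, b⟩ ∧ (H i).Adj a b
  symm := ⟨fun _ _ ⟨i, a, b, hx, hy, h⟩ => ⟨i, b, a, hy, hx, h.symm⟩⟩
  loopless := ⟨by
    rintro x ⟨i, a, b, hx, hy, h⟩
    have hab : a = b := by simpa using hx.symm.trans hy
    exact h.ne hab⟩

/-- A disjoint union of finite graphs is locally finite. -/
noncomputable instance disjointUnionLocallyFinite [∀ i, Finite (W i)] (H : ∀ i, SimpleGraph (W i)) :
    (disjointUnion H).LocallyFinite := fun x =>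
  Set.Finite.fintype (by
    refine (Set.finite_range (Sigma.mk x.1 : W x.1 → Σ i, W i)).subset ?_
    rintro y ⟨i, a, b, hx, hy, -⟩
    subst hx
    exact ⟨b, hy.symm⟩)

end DisjointUnion

end SimpleGraph

/-! The Laplacian is block diagonal, with diagonal blocks the identity and off-diagonal blocks the
constant `k × l` matrix with entries `1 / √(k l)`, up to sign, and its transpose. So everything
turns on whether these rank-one matrices of norm one can be approximated in norm by matrices with a
uniform number of non-zero entries per row and column.

Bounded ratios: expanders do this. On the torus `(ZMod m)²` let `A` average the identity, the two
unit translations and the two shears. Each row and column of `A ^ t` has at most `5 ^ t` non-zero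
entries, while `A ^ t` tends geometrically, at a rate independent of `m`, to the projection onto
constants, which is the constant matrix `1 / m²`. Taking `m²` comparable to `min k l` and pulling
back along maps to the torus with bounded fibres gives the required `k × l` matrices
(`exists_rowSparse_approx`).

The uniform gap (`ZMod.sum_norm_sq_le_of_sum_eq_zero`) is proved in Fourier space. Sum zero means
that the transform vanishes at the origin; a translation multiplies by a character, and a shear acts
as the inverse of the other shear. Large frequencies are controlled by the translations. Near the
origin the torus looks like `ℤ²`, where the nonzero points split into two pairs of opposite
quadrants, each sent into two disjoint parts of itself by two shears. Almost invariant mass would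
have to double there, so it cannot concentrate near the origin.

Unbounded ratios: if `l > 2 d k`, the `k` rows of a `d`-sparse matrix miss more than half of the `l`
columns. The indicator function of the missed columns shows that the distance to the Laplacian is at
least `1 / 2`. -/

/-- If `σ` and `τ` map `A` into disjoint parts of `Q`, then the mass of `A` is controlled by the mass
of `Q \ A` and the variation of `μ` along `σ` and `τ`. -/
theorem sum_le_of_disjoint_images {G : Type*} [Fintype G] [DecidableEq G] {μ : G → ℝ}
    (hμ : ∀ w, 0 ≤ μ w) (σ τ : Equiv.Perm G) {A Q : Finset G} (hA : A ⊆ Q)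
    (hσ : ∀ w ∈ A, σ w ∈ Q) (hτ : ∀ w ∈ A, τ w ∈ Q) (hd : ∀ v ∈ A, ∀ w ∈ A, σ v ≠ τ w) :
    ∑ w ∈ A, μ w ≤
      ∑ w ∈ Q \ A, μ w + ∑ w, |μ (σ w) - μ w| + ∑ w, |μ (τ w) - μ w| := by
  -- Both images lie disjointly in `Q`. Replacing each image's mass by that of `A` costs one
  -- variation term, so `2 μ(A) ≤ μ(Q)` up to the two variations; cancelling one `μ(A)` leaves `Q \
  -- A`.
  have h1 : ∑ w ∈ A, μ (σ w) + ∑ w ∈ A, μ (τ w) ≤ ∑ w ∈ Q, μ w := by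
    have hdis : Disjoint (A.map σ.toEmbedding) (A.map τ.toEmbedding) := by
      rw [Finset.disjoint_left]
      intro x hx hy
      obtain ⟨v, hv, rfl⟩ := Finset.mem_map.1 hx
      obtain ⟨w, hw, h⟩ := Finset.mem_map.1 hy
      exact hd v hv w hw h.symm
    have := Finset.sum_le_sum_of_subset_of_nonneg (f := μ)
      (s := A.map σ.toEmbedding ∪ A.map τ.toEmbedding) (t := Q) (by
        intro x hx
        rcases Finset.mem_union.1 hx with hx | hx <;> obtain ⟨v, hv, rfl⟩ := Finset.mem_map.1 hx
        exacts [hσ v hv, hτ v hv]) (fun _ _ _ => hμ _)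
    rw [Finset.sum_union hdis, Finset.sum_map, Finset.sum_map] at this
    exact this
  have h2 : ∀ ρ : Equiv.Perm G, ∑ w ∈ A, μ w - ∑ w ∈ A, μ (ρ w) ≤ ∑ w, |μ (ρ w) - μ w| := by
    intro ρ
    rw [← Finset.sum_sub_distrib]
    calc ∑ w ∈ A, (μ w - μ (ρ w)) ≤ ∑ w ∈ A, |μ (ρ w) - μ w| :=
          Finset.sum_le_sum fun w _ => by rw [abs_sub_comm]; exact le_abs_self _
      _ ≤ _ := Finset.sum_le_sum_of_subset_of_nonneg (Finset.subset_univ _)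
          fun _ _ _ => abs_nonneg _
  have h3 := Finset.sum_sdiff (f := μ) hA
  linarith [h2 σ, h2 τ]

theorem sum_abs_apply_symm_sub {G : Type*} [Fintype G] (μ : G → ℝ) (σ : Equiv.Perm G) :
    ∑ w, |μ (σ.symm w) - μ w| = ∑ w, |μ (σ w) - μ w| := by
  rw [← Equiv.sum_comp σ]
  exact Finset.sum_congr rfl fun w _ => by rw [Equiv.symm_apply_apply, abs_sub_comm]

/-- Factor the difference of squares and apply AM-GM. The weights keep the coefficient of the total
mass small enough to be absorbed on the left later. -/
theorem sum_abs_norm_sq_sub_le {G E : Type*} [Fintype G] [SeminormedAddCommGroup E] (h : G → E)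
    (σ : Equiv.Perm G) :
    ∑ w, |‖h (σ w)‖ ^ 2 - ‖h w‖ ^ 2| ≤
      8 * ∑ w, ‖h (σ w) - h w‖ ^ 2 + (1 / 8) * ∑ w, ‖h w‖ ^ 2 := by
  have h1 : ∑ w, ‖h w‖ ^ 2 = (1 / 2) * ∑ w, ‖h (σ w)‖ ^ 2 + (1 / 2) * ∑ w, ‖h w‖ ^ 2 := by
    rw [Equiv.sum_comp σ fun w => ‖h w‖ ^ 2]; ring
  rw [h1]
  simp only [Finset.mul_sum, ← Finset.sum_add_distrib]
  refine Finset.sum_le_sum fun w _ => ?_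
  have h2 := abs_norm_sub_norm_le (h (σ w)) (h w)
  have h3 : |‖h (σ w)‖ ^ 2 - ‖h w‖ ^ 2| = |‖h (σ w)‖ - ‖h w‖| * (‖h (σ w)‖ + ‖h w‖) := by
    rw [sq_sub_sq, mul_comm, abs_mul, abs_of_nonneg (a := ‖h (σ w)‖ + ‖h w‖) (by positivity)]
  rw [h3]
  -- With `δ = ‖h (σ w) - h w‖` and `s` the sum of the two norms, `δ s ≤ 8 δ² + s² / 32`, and `s²`
  -- is at most twice the sum of the squares.
  nlinarith [mul_le_mul_of_nonneg_right h2 (add_nonneg (norm_nonneg (h (σ w))) (norm_nonneg (h w))),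
    sq_nonneg (16 * ‖h (σ w) - h w‖ - (‖h (σ w)‖ + ‖h w‖)), sq_nonneg (‖h (σ w)‖ - ‖h w‖)]

/-! ### Spectral gap of the discrete torus -/

namespace ZMod

variable {m : ℕ}

/-- The shear `(x, y) ↦ (x + y, y)` of the discrete torus. -/
def shearFst (m : ℕ) : Equiv.Perm (ZMod m × ZMod m) where
  toFun z := (z.1 + z.2, z.2)
  invFun z := (z.1 - z.2, z.2)
  left_inv z := by simp
  right_inv z := by simp

/-- The shear `(x, y) ↦ (x, x + y)` of the discrete torus. -/
def shearSnd (m : ℕ) : Equiv.Perm (ZMod m × ZMod m) where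
  toFun z := (z.1, z.1 + z.2)
  invFun z := (z.1, z.2 - z.1)
  left_inv z := by simp
  right_inv z := by simp

@[simp] theorem shearFst_apply (z : ZMod m × ZMod m) : shearFst m z = (z.1 + z.2, z.2) := rfl
@[simp] theorem shearSnd_apply (z : ZMod m × ZMod m) : shearSnd m z = (z.1, z.1 + z.2) := rfl
@[simp] theorem shearFst_symm_apply (z : ZMod m × ZMod m) :
    (shearFst m).symm z = (z.1 - z.2, z.2) := rfl
@[simp] theorem shearSnd_symm_apply (z : ZMod m × ZMod m) :
    (shearSnd m).symm z = (z.1, z.2 - z.1) := rfl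

/-- Each summand is below `m / 4` in absolute value, so the integer sum stays within `m / 2` and
does not wrap around: small points behave as in `ℤ²`. -/
theorem valMinAbs_add_of_small [NeZero m] {x y : ZMod m} (hx : 4 * |x.valMinAbs| < m)
    (hy : 4 * |y.valMinAbs| < m) : (x + y).valMinAbs = x.valMinAbs + y.valMinAbs := by
  rw [valMinAbs_spec]
  refine ⟨by simp, ?_⟩
  simp only [Set.mem_Ioc]
  constructor <;> cases abs_cases x.valMinAbs <;> cases abs_cases y.valMinAbs <;> omega

theorem valMinAbs_sub_of_small [NeZero m] {x y : ZMod m} (hx : 4 * |x.valMinAbs| < m)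
    (hy : 4 * |y.valMinAbs| < m) : (x - y).valMinAbs = x.valMinAbs - y.valMinAbs := by
  rw [valMinAbs_spec]
  refine ⟨by simp, ?_⟩
  simp only [Set.mem_Ioc]
  constructor <;> cases abs_cases x.valMinAbs <;> cases abs_cases y.valMinAbs <;> omega

/-- A function on the discrete torus that vanishes at the origin and is almost invariant under the
two shears has a definite proportion of its mass away from the origin. -/
theorem sum_norm_sq_le_of_apply_zero [NeZero m] (h : ZMod m × ZMod m → ℂ) (h0 : h 0 = 0) :
    ∑ w, ‖h w‖ ^ 2 ≤ 32 * ∑ w, ‖h (shearFst m w) - h w‖ ^ 2 +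
      32 * ∑ w, ‖h (shearSnd m w) - h w‖ ^ 2 +
      6 * ∑ w with ¬ (4 * |w.1.valMinAbs| < (m : ℤ) ∧ 4 * |w.2.valMinAbs| < (m : ℤ)), ‖h w‖ ^ 2 := by
  classical
  set small : ZMod m × ZMod m → Prop :=
    fun w => 4 * |w.1.valMinAbs| < m ∧ 4 * |w.2.valMinAbs| < m with hsmall
  -- `q₁` and `q₂` are the two pairs of opposite quadrants; the half-axes are distributed so that
  -- together they partition the nonzero points.
  obtain ⟨q₁, hq₁⟩ : ∃ q : ZMod m × ZMod m → Prop, q = fun w =>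
    (0 < w.1.valMinAbs ∧ 0 ≤ w.2.valMinAbs) ∨ (w.1.valMinAbs < 0 ∧ w.2.valMinAbs ≤ 0) := ⟨_, rfl⟩
  obtain ⟨q₂, hq₂⟩ : ∃ q : ZMod m × ZMod m → Prop, q = fun w =>
    (0 < w.2.valMinAbs ∧ w.1.valMinAbs ≤ 0) ∨ (w.2.valMinAbs < 0 ∧ 0 ≤ w.1.valMinAbs) := ⟨_, rfl⟩
  set μ : ZMod m × ZMod m → ℝ := fun w => ‖h w‖ ^ 2 with hμ
  have μ0 : ∀ w, 0 ≤ μ w := fun w => by positivity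
  set δ := ∑ w with ¬ small w, μ w with hδ
  have key : ∀ q : ZMod m × ZMod m → Prop, ∀ σ τ : Equiv.Perm (ZMod m × ZMod m),
      (∀ w, small w → q w → q (σ w)) → (∀ w, small w → q w → q (τ w)) →
      (∀ v w, small v → q v → small w → q w → σ v ≠ τ w) →
      ∑ w with small w ∧ q w, μ w ≤
        δ + ∑ w, |μ (σ w) - μ w| + ∑ w, |μ (τ w) - μ w| := by
    intro q σ τ hσ hτ hd
    refine (sum_le_of_disjoint_images μ0 σ τ (Q := {w | q w}) ?_ ?_ ?_ ?_).trans ?_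
    · intro w; simp +contextual
    · intro w; simp only [Finset.mem_filter, Finset.mem_univ, true_and]; exact fun h => hσ w h.1 h.2
    · intro w; simp only [Finset.mem_filter, Finset.mem_univ, true_and]; exact fun h => hτ w h.1 h.2
    · intro v hv w hw
      simp only [Finset.mem_filter, Finset.mem_univ, true_and] at hv hw
      exact hd v w hv.1 hv.2 hw.1 hw.2
    · gcongr
      refine Finset.sum_le_sum_of_subset_of_nonneg ?_ fun _ _ _ => μ0 _
      intro w
      simp only [Finset.mem_sdiff, Finset.mem_filter, Finset.mem_univ, true_and]
      tauto
  -- In `q₁` the coordinates have no opposite signs, so adding them increases absolute values: the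
  -- first shear gives points with `|x| > |y|`, the second points with `|x| ≤ |y|`.
  have k₁ := key q₁ (shearFst m) (shearSnd m)
    (by
      rintro w ⟨hs, hs'⟩ hq
      simp only [hq₁, shearFst_apply, valMinAbs_add_of_small hs hs'] at hq ⊢
      omega)
    (by
      rintro w ⟨hs, hs'⟩ hq
      simp only [hq₁, shearSnd_apply, valMinAbs_add_of_small hs hs'] at hq ⊢
      omega)
    (by
      rintro v w ⟨hs, hs'⟩ hq ⟨ht, ht'⟩ hr he
      have h1 := congrArg (fun z => z.1.valMinAbs) he
      have h2 := congrArg (fun z => z.2.valMinAbs) he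
      simp only [shearFst_apply, shearSnd_apply, valMinAbs_add_of_small hs hs',
        valMinAbs_add_of_small ht ht'] at h1 h2
      simp only [hq₁] at hq hr
      omega)
  -- In `q₂` the signs are opposite, so subtraction plays the same role and the inverse shears are
  -- used.
  have k₂ := key q₂ (shearFst m).symm (shearSnd m).symm
    (by
      rintro w ⟨hs, hs'⟩ hq
      simp only [hq₂, shearFst_symm_apply, valMinAbs_sub_of_small hs hs'] at hq ⊢
      omega)
    (by
      rintro w ⟨hs, hs'⟩ hq
      simp only [hq₂, shearSnd_symm_apply, valMinAbs_sub_of_small hs' hs] at hq ⊢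
      omega)
    (by
      rintro v w ⟨hs, hs'⟩ hq ⟨ht, ht'⟩ hr he
      have h1 := congrArg (fun z => z.1.valMinAbs) he
      have h2 := congrArg (fun z => z.2.valMinAbs) he
      simp only [shearFst_symm_apply, shearSnd_symm_apply, valMinAbs_sub_of_small hs hs',
        valMinAbs_sub_of_small ht' ht] at h1 h2
      simp only [hq₂] at hq hr
      omega)
  rw [sum_abs_apply_symm_sub, sum_abs_apply_symm_sub] at k₂
  have htot : ∑ w, μ w ≤ δ + ∑ w with small w ∧ q₁ w, μ w + ∑ w with small w ∧ q₂ w, μ w := by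
    simp only [hδ, Finset.sum_filter, ← Finset.sum_add_distrib]
    refine Finset.sum_le_sum fun w _ => ?_
    by_cases hs : small w
    · by_cases h1 : q₁ w
      · simp only [hs, h1, not_true, if_false, true_and, if_true]
        split_ifs <;> linarith [μ0 w]
      by_cases h2 : q₂ w
      · simp [hs, h1, h2]
      · have hw : w = 0 := by
          simp only [hq₁, hq₂] at h1 h2
          have hx : w.1.valMinAbs = 0 := by omega
          have hy : w.2.valMinAbs = 0 := by omega
          exact Prod.ext ((valMinAbs_eq_zero _).1 hx) ((valMinAbs_eq_zero _).1 hy)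
        simp [hμ, hw, h0]
    · simp [hs]
  have v₁ := sum_abs_norm_sq_sub_le h (shearFst m)
  have v₂ := sum_abs_norm_sq_sub_le h (shearSnd m)
  simp only [hμ] at *
  -- With `V₁`, `V₂` the variations of `μ`, the total is at most `3 δ + 2 (V₁ + V₂)`. Each `Vᵢ`
  -- contains an eighth of the total, so half of the total is absorbed, whence `32` and `6`.
  linarith

/-- The (unnormalized) Fourier transform on the discrete torus. -/
noncomputable def torusFourier [NeZero m] (f : ZMod m × ZMod m → ℂ) (w : ZMod m × ZMod m) : ℂ :=
  ∑ z, f z * stdAddChar (z.1 * w.1 + z.2 * w.2)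

section Fourier

variable [NeZero m] (f g : ZMod m × ZMod m → ℂ)

theorem torusFourier_sub (w : ZMod m × ZMod m) :
    torusFourier (f - g) w = torusFourier f w - torusFourier g w := by
  simp [torusFourier, sub_mul, Finset.sum_sub_distrib]

theorem torusFourier_zero : torusFourier f 0 = ∑ z, f z := by
  simp [torusFourier]

/-- The transform turns a linear change of variables into its inverse transpose, and the transpose
of one shear is the other. -/
theorem torusFourier_shearFst (w : ZMod m × ZMod m) :
    torusFourier (f ∘ shearFst m) w = torusFourier f ((shearSnd m).symm w) := by
  unfold torusFourier
  rw [← Equiv.sum_comp (shearFst m) fun z => f z * _]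
  refine Finset.sum_congr rfl fun z _ => ?_
  simp only [Function.comp_apply, shearFst_apply, shearSnd_symm_apply]
  congr 2; ring

theorem torusFourier_shearSnd (w : ZMod m × ZMod m) :
    torusFourier (f ∘ shearSnd m) w = torusFourier f ((shearFst m).symm w) := by
  unfold torusFourier
  rw [← Equiv.sum_comp (shearSnd m) fun z => f z * _]
  refine Finset.sum_congr rfl fun z _ => ?_
  simp only [Function.comp_apply, shearSnd_apply, shearFst_symm_apply]
  congr 2; ring

theorem torusFourier_translate (a w : ZMod m × ZMod m) :
    torusFourier (f ∘ Equiv.addRight a) w =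
      stdAddChar (-(a.1 * w.1 + a.2 * w.2)) * torusFourier f w := by
  unfold torusFourier
  rw [← Equiv.sum_comp (Equiv.addRight a) fun z => f z * _, Finset.mul_sum]
  refine Finset.sum_congr rfl fun z _ => ?_
  simp only [Function.comp_apply, Equiv.coe_addRight, Prod.fst_add, Prod.snd_add]
  rw [mul_left_comm, ← AddChar.map_add_eq_mul]
  congr 2; ring

theorem conj_stdAddChar (a : ZMod m) : (starRingEnd ℂ) (stdAddChar a) = stdAddChar (-a) := by
  rw [stdAddChar_apply, stdAddChar_apply, AddChar.map_neg_eq_inv, Circle.coe_inv_eq_conj]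

theorem sum_stdAddChar_torus (a : ZMod m × ZMod m) :
    ∑ w : ZMod m × ZMod m, stdAddChar (a.1 * w.1 + a.2 * w.2) =
      if a = 0 then (m : ℂ) ^ 2 else 0 := by
  have h1 := fun x : ZMod m => AddChar.sum_mulShift x (isPrimitive_stdAddChar m)
  simp only [AddChar.map_add_eq_mul, mul_comm a.1, mul_comm a.2]
  rw [Fintype.sum_prod_type]
  simp only [← Finset.mul_sum, ← Finset.sum_mul, h1, ZMod.card]
  rcases a with ⟨x, y⟩
  by_cases hx : x = 0 <;> by_cases hy : y = 0 <;> simp [hx, hy, sq, Prod.ext_iff]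

/-- Parseval, by expanding the square and using orthogonality of characters; the factor is the order
of the group. -/
theorem sum_norm_torusFourier_sq :
    ∑ w, ‖torusFourier f w‖ ^ 2 = (m : ℝ) ^ 2 * ∑ z, ‖f z‖ ^ 2 := by
  have key : ∑ w, torusFourier f w * (starRingEnd ℂ) (torusFourier f w) =
      (m : ℂ) ^ 2 * ∑ z, f z * (starRingEnd ℂ) (f z) := by
    calc ∑ w, torusFourier f w * (starRingEnd ℂ) (torusFourier f w)
        = ∑ w : ZMod m × ZMod m, ∑ z : ZMod m × ZMod m, ∑ z' : ZMod m × ZMod m,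
            (f z * (starRingEnd ℂ) (f z')) *
            stdAddChar ((z - z').1 * w.1 + (z - z').2 * w.2) := by
          refine Finset.sum_congr rfl fun w _ => ?_
          simp only [torusFourier, map_sum, map_mul, conj_stdAddChar, Finset.sum_mul_sum]
          refine Finset.sum_congr rfl fun z _ => Finset.sum_congr rfl fun z' _ => ?_
          rw [mul_mul_mul_comm, ← AddChar.map_add_eq_mul]
          congr 2
          simp only [Prod.fst_sub, Prod.snd_sub]; ring
      _ = ∑ z : ZMod m × ZMod m, ∑ z' : ZMod m × ZMod m, (f z * (starRingEnd ℂ) (f z')) *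
            ∑ w : ZMod m × ZMod m, stdAddChar ((z - z').1 * w.1 + (z - z').2 * w.2) := by
          rw [Finset.sum_comm]
          refine Finset.sum_congr rfl fun z _ => ?_
          rw [Finset.sum_comm]
          simp only [Finset.mul_sum]
      _ = _ := by
          simp only [sum_stdAddChar_torus, sub_eq_zero, mul_ite, mul_zero, Finset.sum_ite_eq,
            Finset.mem_univ, if_true, Finset.mul_sum]
          exact Finset.sum_congr rfl fun z _ => by ring
  simp only [Complex.mul_conj'] at key
  exact_mod_cast key

end Fourier

/-- The angle has absolute value between `π / 2` and `π`, so its cosine is nonpositive, and the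
squared distance to `1` is `2 - 2 cos`. -/
theorem two_le_norm_stdAddChar_sub_one_sq [NeZero m] {x : ZMod m}
    (hx : ¬ 4 * |x.valMinAbs| < m) : 2 ≤ ‖(stdAddChar x : ℂ) - 1‖ ^ 2 := by
  have hm : (0 : ℝ) < m := by exact_mod_cast Nat.pos_of_ne_zero (NeZero.ne m)
  have hle : |x.valMinAbs| * 2 ≤ m := by
    have := x.valMinAbs_mem_Ioc
    rw [Set.mem_Ioc] at this
    cases abs_cases x.valMinAbs <;> omega
  set j := x.valMinAbs with hj
  have he : (stdAddChar x : ℂ) = Complex.exp (((2 * Real.pi * j / m : ℝ) : ℂ) * Complex.I) := by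
    conv_lhs => rw [← coe_valMinAbs x, stdAddChar_coe]
    push_cast
    congr 1; rw [← hj]; ring
  have hcos : Real.cos (2 * Real.pi * j / m) ≤ 0 := by
    have habs : |2 * Real.pi * j / m| = 2 * Real.pi * (|j| : ℤ) / m := by
      rw [abs_div, abs_mul, abs_of_pos Real.two_pi_pos, abs_of_pos hm, Int.cast_abs]
    have h1 : (m : ℝ) ≤ 4 * (|j| : ℤ) := by exact_mod_cast not_lt.1 hx
    have h2 : ((|j| : ℤ) : ℝ) * 2 ≤ m := by exact_mod_cast hle
    rw [← Real.cos_abs, habs]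
    apply Real.cos_nonpos_of_pi_div_two_le_of_le
    · rw [le_div_iff₀ hm]; nlinarith [Real.pi_pos]
    · rw [div_le_iff₀ hm]; nlinarith [Real.pi_pos]
  rw [he, ← Complex.normSq_eq_norm_sq, Complex.normSq_apply]
  simp only [Complex.sub_re, Complex.sub_im, Complex.one_re, Complex.one_im,
    Complex.exp_ofReal_mul_I_re, Complex.exp_ofReal_mul_I_im, sub_zero]
  nlinarith [Real.sin_sq_add_cos_sq (2 * Real.pi * j / m)]

/-- The spectral gap of the discrete torus for the two unit translations and the two shears. -/
theorem sum_norm_sq_le_of_sum_eq_zero [NeZero m] (f : ZMod m × ZMod m → ℂ) (hf : ∑ z, f z = 0) :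
    ∑ z, ‖f z‖ ^ 2 ≤ 32 * (∑ z, ‖f (z + (1, 0)) - f z‖ ^ 2 + ∑ z, ‖f (z + (0, 1)) - f z‖ ^ 2 +
      ∑ z, ‖f (shearFst m z) - f z‖ ^ 2 + ∑ z, ‖f (shearSnd m z) - f z‖ ^ 2) := by
  have hm : (0 : ℝ) < (m : ℝ) ^ 2 := by
    have : (0 : ℝ) < m := by exact_mod_cast Nat.pos_of_ne_zero (NeZero.ne m)
    positivity
  set F := torusFourier f with hF
  have hdiff : ∀ σ : Equiv.Perm (ZMod m × ZMod m),
      (m : ℝ) ^ 2 * ∑ z, ‖f (σ z) - f z‖ ^ 2 = ∑ w, ‖torusFourier (f ∘ σ) w - F w‖ ^ 2 := by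
    intro σ
    rw [hF]
    simp only [← torusFourier_sub]
    rw [sum_norm_torusFourier_sq]
    rfl
  have e₁ := hdiff (Equiv.addRight (1, 0))
  have e₂ := hdiff (Equiv.addRight (0, 1))
  have e₃ := hdiff (shearFst m)
  have e₄ := hdiff (shearSnd m)
  simp only [torusFourier_translate, torusFourier_shearFst, torusFourier_shearSnd, ← hF] at e₁ e₂ e₃ e₄
  simp only [Equiv.coe_addRight, one_mul, zero_mul, add_zero, zero_add] at e₁ e₂
  have hsymm : ∀ σ : Equiv.Perm (ZMod m × ZMod m),
      ∑ w, ‖F (σ.symm w) - F w‖ ^ 2 = ∑ w, ‖F (σ w) - F w‖ ^ 2 := by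
    intro σ
    rw [← Equiv.sum_comp σ]
    exact Finset.sum_congr rfl fun w _ => by rw [Equiv.symm_apply_apply, norm_sub_rev]
  rw [hsymm] at e₃ e₄
  have hmul : ∀ (c : ℂ) (w : ZMod m × ZMod m), ‖c * F w - F w‖ ^ 2 = ‖c - 1‖ ^ 2 * ‖F w‖ ^ 2 := by
    intro c w
    rw [← mul_pow, ← norm_mul, sub_mul, one_mul]
  have hneg : ∀ x : ZMod m, ‖(stdAddChar (-x) : ℂ) - 1‖ = ‖(stdAddChar x : ℂ) - 1‖ := by
    intro x
    rw [← conj_stdAddChar, ← map_one (starRingEnd ℂ), ← map_sub, RCLike.norm_conj, map_one]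
  simp only [hmul, hneg] at e₁ e₂
  have hlarge : 2 * ∑ w with ¬ (4 * |w.1.valMinAbs| < (m : ℤ) ∧ 4 * |w.2.valMinAbs| < (m : ℤ)), ‖F w‖ ^ 2 ≤
      ∑ w, ‖(stdAddChar w.1 : ℂ) - 1‖ ^ 2 * ‖F w‖ ^ 2 +
        ∑ w, ‖(stdAddChar w.2 : ℂ) - 1‖ ^ 2 * ‖F w‖ ^ 2 := by
    rw [Finset.sum_filter, Finset.mul_sum, ← Finset.sum_add_distrib]
    refine Finset.sum_le_sum fun w _ => ?_
    split_ifs with hw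
    swap
    · rcases not_and_or.1 hw with hw | hw
      · have := mul_le_mul_of_nonneg_right (two_le_norm_stdAddChar_sub_one_sq hw)
          (sq_nonneg ‖F w‖)
        have : 0 ≤ ‖(stdAddChar w.2 : ℂ) - 1‖ ^ 2 * ‖F w‖ ^ 2 := by positivity
        linarith
      · have := mul_le_mul_of_nonneg_right (two_le_norm_stdAddChar_sub_one_sq hw)
          (sq_nonneg ‖F w‖)
        have : 0 ≤ ‖(stdAddChar w.1 : ℂ) - 1‖ ^ 2 * ‖F w‖ ^ 2 := by positivity
        linarith
    · rw [mul_zero]; positivity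
  have main := sum_norm_sq_le_of_apply_zero F (by rw [hF, torusFourier_zero, hf])
  have hP := sum_norm_torusFourier_sq f
  rw [← hF] at hP
  refine le_of_mul_le_mul_left ?_ hm
  rw [← hP]
  have p₁ : 0 ≤ ∑ w, ‖(stdAddChar w.1 : ℂ) - 1‖ ^ 2 * ‖F w‖ ^ 2 := by positivity
  have p₂ : 0 ≤ ∑ w, ‖(stdAddChar w.2 : ℂ) - 1‖ ^ 2 * ‖F w‖ ^ 2 := by positivity
  linarith

end ZMod

/-! ### Sparse matrices and averages of permutation matrices -/

namespace Matrix

/-- Every row of `A` is supported on a finite set with at most `d` elements. -/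
def RowSparse {m n R : Type*} [Zero R] (A : Matrix m n R) (d : ℕ) : Prop :=
  ∀ i, ∃ s : Finset n, s.card ≤ d ∧ ∀ j ∉ s, A i j = 0

section RowSparse

variable {m n p R : Type*}

theorem RowSparse.mono [Zero R] {A : Matrix m n R} {d e : ℕ} (hA : A.RowSparse d) (h : d ≤ e) :
    A.RowSparse e := fun i =>
  let ⟨s, hs, hs'⟩ := hA i
  ⟨s, hs.trans h, hs'⟩

theorem rowSparse_one [DecidableEq n] [Zero R] [One R] : (1 : Matrix n n R).RowSparse 1 :=
  fun i => ⟨{i}, by simp, fun j hj => one_apply_ne fun h => hj (by simp [h])⟩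

theorem RowSparse.mul [Fintype n] [NonUnitalNonAssocSemiring R] {A : Matrix m n R}
    {B : Matrix n p R} {d e : ℕ} (hA : A.RowSparse d) (hB : B.RowSparse e) :
    (A * B).RowSparse (d * e) := by
  classical
  choose t ht ht' using hB
  intro i
  obtain ⟨s, hs, hs'⟩ := hA i
  refine ⟨s.biUnion t, (Finset.card_biUnion_le_card_mul _ _ _ fun j _ => ht j).trans
    (Nat.mul_le_mul_right _ hs), fun k hk => ?_⟩
  rw [mul_apply]
  refine Finset.sum_eq_zero fun j _ => ?_
  by_cases hj : j ∈ s
  · rw [ht' j k fun h => hk (Finset.mem_biUnion.2 ⟨j, hj, h⟩), mul_zero]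
  · rw [hs' j hj, zero_mul]

theorem RowSparse.pow [Fintype n] [DecidableEq n] [Semiring R] {A : Matrix n n R} {d : ℕ}
    (hA : A.RowSparse d) (t : ℕ) : (A ^ t).RowSparse (d ^ t) := by
  induction t with
  | zero => simpa using rowSparse_one
  | succ t ih => rw [pow_succ, pow_succ]; exact ih.mul hA

theorem RowSparse.smul [MulZeroClass R] {A : Matrix m n R} {d : ℕ} (hA : A.RowSparse d) (a : R) :
    (a • A).RowSparse d := fun i =>
  let ⟨s, hs, hs'⟩ := hA i
  ⟨s, hs, fun j hj => by rw [smul_apply, hs' j hj, smul_zero]⟩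

theorem RowSparse.submatrix {α β : Type*} [Fintype β] [DecidableEq n] [Zero R] {A : Matrix m n R}
    {d c : ℕ} (hA : A.RowSparse d) (φ : α → m) (ψ : β → n)
    (hψ : ∀ q, (Finset.univ.filter fun j => ψ j = q).card ≤ c) :
    (A.submatrix φ ψ).RowSparse (d * c) := by
  classical
  intro i
  obtain ⟨s, hs, hs'⟩ := hA (φ i)
  refine ⟨s.biUnion fun q => Finset.univ.filter fun j => ψ j = q,
    (Finset.card_biUnion_le_card_mul _ _ _ fun q _ => hψ q).trans (Nat.mul_le_mul_right _ hs),
    fun j hj => hs' _ fun h => hj ?_⟩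
  simpa using h

end RowSparse

/-- The operator factors as summation over the fibres of `ψ`, then `R`, then pullback along `φ`.
Cauchy–Schwarz on fibres makes the first cost a factor `c`; repetition makes the last cost another.
-/
theorem sum_norm_submatrix_mulVec_sq_le {G α β : Type*} [Fintype G] [DecidableEq G] [Fintype α]
    [Fintype β] {R : Matrix G G ℂ} {r : ℝ} (hr : 0 ≤ r)
    (hR : ∀ g : G → ℂ, ∑ p, ‖(R *ᵥ g) p‖ ^ 2 ≤ r * ∑ p, ‖g p‖ ^ 2) {c : ℕ} {φ : α → G} {ψ : β → G}
    (hφ : ∀ q, (Finset.univ.filter fun i => φ i = q).card ≤ c)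
    (hψ : ∀ q, (Finset.univ.filter fun j => ψ j = q).card ≤ c) (f : β → ℂ) :
    ∑ i, ‖(R.submatrix φ ψ *ᵥ f) i‖ ^ 2 ≤ c ^ 2 * r * ∑ j, ‖f j‖ ^ 2 := by
  set g : G → ℂ := fun q => ∑ j with ψ j = q, f j with hg
  have h1 : ∀ i, (R.submatrix φ ψ *ᵥ f) i = (R *ᵥ g) (φ i) := by
    intro i
    simp only [mulVec, dotProduct, submatrix_apply, hg, Finset.mul_sum]
    rw [← Finset.sum_fiberwise Finset.univ ψ]
    refine Finset.sum_congr rfl fun q _ => Finset.sum_congr rfl fun j hj => ?_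
    rw [(Finset.mem_filter.1 hj).2]
  have h2 : ∑ q, ‖g q‖ ^ 2 ≤ c * ∑ j, ‖f j‖ ^ 2 := by
    rw [← Finset.sum_fiberwise Finset.univ ψ fun j => ‖f j‖ ^ 2, Finset.mul_sum]
    refine Finset.sum_le_sum fun q _ => ?_
    calc ‖g q‖ ^ 2 ≤ (∑ j with ψ j = q, ‖f j‖) ^ 2 := by gcongr; exact norm_sum_le _ _
      _ ≤ _ := sq_sum_le_card_mul_sum_sq
      _ ≤ _ := by gcongr; exact hψ q
  calc ∑ i, ‖(R.submatrix φ ψ *ᵥ f) i‖ ^ 2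
      = ∑ q, ∑ i with φ i = q, ‖(R *ᵥ g) q‖ ^ 2 := by
        simp only [h1]
        rw [← Finset.sum_fiberwise Finset.univ φ]
        refine Finset.sum_congr rfl fun q _ => Finset.sum_congr rfl fun j hj => ?_
        rw [(Finset.mem_filter.1 hj).2]
    _ ≤ ∑ q, c * ‖(R *ᵥ g) q‖ ^ 2 := by
        refine Finset.sum_le_sum fun q _ => ?_
        rw [Finset.sum_const, nsmul_eq_mul]
        gcongr
        exact hφ q
    _ ≤ c * (r * (c * ∑ j, ‖f j‖ ^ 2)) := by
        rw [← Finset.mul_sum]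
        gcongr
        exact (hR g).trans (by gcongr)
    _ = _ := by ring

section PermAverage

variable {ι G : Type*} [Fintype ι] [DecidableEq G]

/-- The average of the permutation matrices of a finite family of permutations. -/
noncomputable def permAverage (σ : ι → Equiv.Perm G) : Matrix G G ℂ :=
  of fun z w => (Fintype.card ι : ℂ)⁻¹ * ∑ j, if σ j z = w then 1 else 0

theorem permAverage_mulVec [Fintype G] (σ : ι → Equiv.Perm G) (f : G → ℂ) (z : G) :
    (permAverage σ *ᵥ f) z = (Fintype.card ι : ℂ)⁻¹ * ∑ j, f (σ j z) := by
  simp only [mulVec, dotProduct, permAverage, of_apply, mul_assoc, Finset.sum_mul, ← Finset.mul_sum]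
  rw [Finset.sum_comm]
  simp

theorem rowSparse_permAverage (σ : ι → Equiv.Perm G) :
    (permAverage σ).RowSparse (Fintype.card ι) := fun z =>
  ⟨Finset.univ.image fun j => σ j z, Finset.card_image_le, fun w hw => by
    have : ∀ j, σ j z ≠ w := fun j h => hw (by simp [← h])
    simp [permAverage, this]⟩

/-- Transposes are again permutation averages, so column sparsity reduces to row sparsity. -/
theorem transpose_permAverage (σ : ι → Equiv.Perm G) :
    (permAverage σ)ᵀ = permAverage fun j => (σ j).symm := by
  ext z w
  simp only [transpose_apply, permAverage, of_apply, Equiv.symm_apply_eq]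
  simp only [eq_comm]

theorem permAverage_mulVec_const [Fintype G] [Nonempty ι] (σ : ι → Equiv.Perm G) (a : ℂ) :
    permAverage σ *ᵥ (fun _ => a) = fun _ => a := by
  ext z
  rw [permAverage_mulVec]
  simp

theorem sum_permAverage_mulVec [Fintype G] [Nonempty ι] (σ : ι → Equiv.Perm G) (f : G → ℂ) :
    ∑ z, (permAverage σ *ᵥ f) z = ∑ z, f z := by
  simp only [permAverage_mulVec]
  rw [← Finset.mul_sum, Finset.sum_comm]
  simp only [Equiv.sum_comp]
  simp

/-- A contraction estimate on functions with sum zero yields a bound for the distance of the powers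
of an average of permutation matrices to the projection onto the constant functions. -/
theorem sum_norm_permAverage_pow_sub_mulVec_sq_le [Fintype G] [Nonempty ι] [Nonempty G]
    (σ : ι → Equiv.Perm G) {r : ℝ} (hr : 0 ≤ r)
    (h : ∀ f : G → ℂ, ∑ z, f z = 0 →
      ∑ z, ‖(permAverage σ *ᵥ f) z‖ ^ 2 ≤ r * ∑ z, ‖f z‖ ^ 2) (t : ℕ) (f : G → ℂ) :
    ∑ z, ‖((permAverage σ ^ t - of fun _ _ => (Fintype.card G : ℂ)⁻¹) *ᵥ f) z‖ ^ 2 ≤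
      r ^ t * ∑ z, ‖f z‖ ^ 2 := by
  have hpow : ∀ (t : ℕ) (f : G → ℂ), ∑ z, f z = 0 →
      ∑ z, (permAverage σ ^ t *ᵥ f) z = 0 ∧
      ∑ z, ‖(permAverage σ ^ t *ᵥ f) z‖ ^ 2 ≤ r ^ t * ∑ z, ‖f z‖ ^ 2 := by
    intro t
    induction t with
    | zero => intro f hf; simp [hf]
    | succ t ih =>
      intro f hf
      obtain ⟨h1, h2⟩ := ih f hf
      rw [pow_succ', ← mulVec_mulVec, sum_permAverage_mulVec]
      refine ⟨h1, (h _ h1).trans ?_⟩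
      rw [pow_succ', mul_assoc]
      gcongr
  have hconst : ∀ (t : ℕ) (a : ℂ), permAverage σ ^ t *ᵥ (fun _ => a) = fun _ => a := by
    intro t a
    induction t with
    | zero => simp
    | succ t ih => rw [pow_succ, ← mulVec_mulVec, permAverage_mulVec_const, ih]
  have hG : (Fintype.card G : ℂ) ≠ 0 := by exact_mod_cast Fintype.card_ne_zero
  set a : ℂ := (Fintype.card G : ℂ)⁻¹ * ∑ z, f z with ha
  have hsum : ∑ z, (f z - a) = 0 := by
    rw [Finset.sum_sub_distrib, Finset.sum_const, Finset.card_univ, nsmul_eq_mul, ha,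
      mul_inv_cancel_left₀ hG, sub_self]
  have heq : (permAverage σ ^ t - of fun _ _ => (Fintype.card G : ℂ)⁻¹) *ᵥ f =
      permAverage σ ^ t *ᵥ fun z => f z - a := by
    have : (fun z => f z - a) = f - fun _ => a := rfl
    rw [this, mulVec_sub, hconst, sub_mulVec]
    congr 1
    ext z
    simp [mulVec, dotProduct, ha, Finset.mul_sum]
  rw [heq]
  refine (hpow t _ hsum).2.trans (mul_le_mul_of_nonneg_left ?_ (pow_nonneg hr t))
  -- Pythagoras: `f - a` is orthogonal to constants, so subtracting the mean does not increase the
  -- norm.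
  have hcross : ∑ z, (starRingEnd ℂ) a * (f z - a) = 0 := by rw [← Finset.mul_sum, hsum, mul_zero]
  have hcross' := congrArg Complex.re hcross
  rw [Complex.re_sum, Complex.zero_re] at hcross'
  have : ∀ z, ‖f z‖ ^ 2 = ‖f z - a‖ ^ 2 + 2 * ((starRingEnd ℂ) a * (f z - a)).re + ‖a‖ ^ 2 := by
    intro z
    simp only [Complex.sq_norm, Complex.normSq_apply, Complex.mul_re, Complex.conj_re,
      Complex.conj_im, Complex.sub_re, Complex.sub_im]
    ring
  simp only [this, Finset.sum_add_distrib, ← Finset.mul_sum, hcross']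
  have : 0 ≤ ∑ _z : G, ‖a‖ ^ 2 := by positivity
  linarith

end PermAverage

end Matrix

/-! ### Expander and approximation of constant matrices -/

open Matrix in
/-- The five permutations of the discrete torus given by the identity, the unit translations and the
shears generate an expander. -/
theorem ZMod.exists_torus_expander (m : ℕ) [NeZero m] :
    ∃ σ : Fin 5 → Equiv.Perm (ZMod m × ZMod m), ∀ f : ZMod m × ZMod m → ℂ, ∑ z, f z = 0 →
      ∑ z, ‖(permAverage σ *ᵥ f) z‖ ^ 2 ≤ (799 / 800) * ∑ z, ‖f z‖ ^ 2 := by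
  refine ⟨![1, Equiv.addRight (1, 0), Equiv.addRight (0, 1), shearFst m, shearSnd m],
    fun f hf => ?_⟩
  have key : ∀ a b c d e : ℂ, ‖(5 : ℂ)⁻¹ * (a + b + c + d + e)‖ ^ 2 ≤ (1 / 25) *
      (5 * (‖a‖ ^ 2 + ‖b‖ ^ 2 + ‖c‖ ^ 2 + ‖d‖ ^ 2 + ‖e‖ ^ 2) -
        (‖b - a‖ ^ 2 + ‖c - a‖ ^ 2 + ‖d - a‖ ^ 2 + ‖e - a‖ ^ 2)) := by
    -- The square of the sum is five times the sum of squares minus all ten squared differences;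
    -- only the four involving `a`, the value moved by the identity, are kept.
    have real : ∀ a b c d e : ℝ, (a + b + c + d + e) ^ 2 ≤
        5 * (a ^ 2 + b ^ 2 + c ^ 2 + d ^ 2 + e ^ 2) -
        ((b - a) ^ 2 + (c - a) ^ 2 + (d - a) ^ 2 + (e - a) ^ 2) := by
      intro a b c d e
      linarith [sq_nonneg (b - c), sq_nonneg (b - d), sq_nonneg (b - e), sq_nonneg (c - d),
        sq_nonneg (c - e), sq_nonneg (d - e)]
    intro a b c d e
    rw [norm_mul, mul_pow]
    have h1 := real a.re b.re c.re d.re e.re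
    have h2 := real a.im b.im c.im d.im e.im
    have h5 : ‖(5 : ℂ)⁻¹‖ ^ 2 = 1 / 25 := by norm_num
    rw [h5]
    simp only [Complex.sq_norm, Complex.normSq_apply, Complex.add_re, Complex.add_im,
      Complex.sub_re, Complex.sub_im]
    linarith
  have hsum : ∀ ρ : Equiv.Perm (ZMod m × ZMod m), ∑ z, ‖f (ρ z)‖ ^ 2 = ∑ z, ‖f z‖ ^ 2 :=
    fun ρ => Equiv.sum_comp ρ fun z => ‖f z‖ ^ 2
  have hgap := sum_norm_sq_le_of_sum_eq_zero f hf
  have s₁ := hsum (Equiv.addRight (1, 0))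
  have s₂ := hsum (Equiv.addRight (0, 1))
  have s₃ := hsum (shearFst m)
  have s₄ := hsum (shearSnd m)
  simp only [Equiv.coe_addRight] at s₁ s₂
  have hle := Finset.sum_le_sum fun z (_ : z ∈ Finset.univ) => key (f z) (f (z + (1, 0)))
    (f (z + (0, 1))) (f (shearFst m z)) (f (shearSnd m z))
  simp only [← Finset.mul_sum, Finset.sum_sub_distrib, Finset.sum_add_distrib, s₁, s₂, s₃, s₄] at hle
  have hM : ∀ z, (permAverage ![1, Equiv.addRight (1, 0), Equiv.addRight (0, 1), shearFst m,
      shearSnd m] *ᵥ f) z = (5 : ℂ)⁻¹ * (f z + f (z + (1, 0)) + f (z + (0, 1)) +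
      f (shearFst m z) + f (shearSnd m z)) := by
    intro z
    rw [permAverage_mulVec, Fin.sum_univ_five]
    simp
  simp only [hM]
  -- The gap constant `32` and the factor `1 / 25` give `1 - 1 / (25 * 32) = 799 / 800`.
  linarith

/-- Reduce indices modulo the order of `G`: within a fibre an index is determined by its quotient,
which is at most `k / Fintype.card G`. -/
theorem exists_map_card_fiber_le (k : ℕ) (G : Type*) [Fintype G] [DecidableEq G] [Nonempty G] :
    ∃ φ : Fin k → G,
      ∀ q, (Finset.univ.filter fun i => φ i = q).card ≤ k / Fintype.card G + 1 := by
  have hN : 0 < Fintype.card G := Fintype.card_pos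
  set N := Fintype.card G
  let e := (Fintype.equivFin G).symm
  refine ⟨fun i => e ⟨i % N, Nat.mod_lt _ hN⟩, fun q => ?_⟩
  rw [← Finset.card_range (k / N + 1)]
  refine Finset.card_le_card_of_injOn (fun i => (i : ℕ) / N) ?_ ?_
  · intro i _
    simp only [Finset.coe_range, Set.mem_Iio]
    exact Nat.lt_succ_of_le (Nat.div_le_div_right i.2.le)
  · intro i hi j hj hij
    simp only [Finset.coe_filter, Finset.mem_univ, true_and, Set.mem_ofPred_eq] at hi hj
    have hmod : (i : ℕ) % N = j % N := by
      have := e.injective (hi.trans hj.symm)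
      simpa using this
    simp only at hij
    ext
    rw [← Nat.div_add_mod (i : ℕ) N, ← Nat.div_add_mod (j : ℕ) N, hij, hmod]

open Matrix in
/-- The rank-one matrices of size `k × l` with all entries `1 / √(k l)` are uniformly approximated
in operator norm by sparse matrices as long as the ratios of `k` and `l` are bounded. -/
theorem exists_rowSparse_approx (C : ℝ) {ε : ℝ} (hε : 0 < ε) :
    ∃ d : ℕ, ∀ k l : ℕ, 0 < k → 0 < l → (k : ℝ) ≤ C * l → (l : ℝ) ≤ C * k →
      ∃ B : Matrix (Fin k) (Fin l) ℂ, B.RowSparse d ∧ Bᵀ.RowSparse d ∧ ∀ f : Fin l → ℂ,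
        ∑ i, ‖((B - of fun _ _ => ((1 / √((k : ℝ) * l) : ℝ) : ℂ)) *ᵥ f) i‖ ^ 2 ≤
          ε * ∑ j, ‖f j‖ ^ 2 := by
  set C' := max C 1 with hC'
  -- `c` bounds the fibres: `k` and `l` are at most `C' * min k l ≤ 4 * C' * m²`. The exponent `t`
  -- is then chosen to beat the loss `c ^ 2` from pulling back.
  set c : ℕ := ⌈4 * C'⌉₊ + 1 with hc
  have hcpos : (0 : ℝ) < (c : ℝ) ^ 2 := by positivity
  obtain ⟨t, ht⟩ := exists_pow_lt_of_lt_one (div_pos hε hcpos)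
    (by norm_num : (799 / 800 : ℝ) < 1)
  refine ⟨5 ^ t * c, fun k l hk hl hkl hlk => ?_⟩
  have hkpos : (0 : ℝ) < k := by exact_mod_cast hk
  have hlpos : (0 : ℝ) < l := by exact_mod_cast hl
  set m := Nat.sqrt (min k l) with hm
  have hmpos : 0 < m := Nat.sqrt_pos.2 (lt_min hk hl)
  have : NeZero m := ⟨hmpos.ne'⟩
  have hcard : Fintype.card (ZMod m × ZMod m) = m * m := by simp
  have hmin : min k l ≤ 4 * (m * m) := by
    have := Nat.sqrt_le_add (min k l)
    nlinarith
  have hmk : m * m ≤ k := (Nat.sqrt_le _).trans (min_le_left _ _)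
  have hml : m * m ≤ l := (Nat.sqrt_le _).trans (min_le_right _ _)
  have hC1 : C ≤ C' := le_max_left _ _
  have hC2 : 1 ≤ C' := le_max_right _ _
  have hfib : ∀ n : ℕ, (n : ℝ) ≤ C' * (min k l : ℕ) → n / (m * m) + 1 ≤ c := by
    intro n hn
    rw [hc]
    refine Nat.succ_le_succ (Nat.div_le_of_le_mul ?_)
    have h1 : ((min k l : ℕ) : ℝ) ≤ 4 * (m * m : ℕ) := by exact_mod_cast hmin
    have h2 := Nat.le_ceil (4 * C')
    have h3 : (n : ℝ) ≤ (m * m : ℕ) * (⌈4 * C'⌉₊ : ℝ) := by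
      calc (n : ℝ) ≤ C' * (4 * (m * m : ℕ)) := hn.trans (by gcongr)
        _ = (m * m : ℕ) * (4 * C') := by ring
        _ ≤ _ := by gcongr
    exact_mod_cast h3
  have hkc : (k : ℝ) ≤ C' * (min k l : ℕ) := by
    rcases min_choice k l with h | h <;> rw [h] <;> nlinarith
  have hlc : (l : ℝ) ≤ C' * (min k l : ℕ) := by
    rcases min_choice k l with h | h <;> rw [h] <;> nlinarith
  obtain ⟨φ, hφ⟩ := exists_map_card_fiber_le k (ZMod m × ZMod m)
  obtain ⟨ψ, hψ⟩ := exists_map_card_fiber_le l (ZMod m × ZMod m)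
  rw [hcard] at hφ hψ
  replace hφ := fun q => (hφ q).trans (hfib k hkc)
  replace hψ := fun q => (hψ q).trans (hfib l hlc)
  obtain ⟨σ, hσ⟩ := ZMod.exists_torus_expander m
  have hpow := sum_norm_permAverage_pow_sub_mulVec_sq_le σ (by norm_num) hσ t
  have hN : ((m * m : ℕ) : ℝ) ≠ 0 := by positivity
  have hs : 0 < √((k : ℝ) * l) := by positivity
  -- Scaling by `a` turns the pulled-back entries `1 / m²` into `1 / √(k l)`. As `m²` is at most
  -- both `k` and `l`, `a ≤ 1` and the error does not grow.
  set a : ℝ := (m * m : ℕ) / √((k : ℝ) * l) with ha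
  have ha0 : 0 ≤ a := by positivity
  have ha1 : a ≤ 1 := by
    rw [ha, div_le_one hs]
    apply Real.le_sqrt_of_sq_le
    rw [sq]
    gcongr
  refine ⟨(a : ℂ) • (permAverage σ ^ t).submatrix φ ψ, ?_, ?_, fun f => ?_⟩
  · exact ((((rowSparse_permAverage σ).pow t).submatrix φ ψ hψ).smul (a : ℂ)).mono (by simp)
  · rw [transpose_smul, transpose_submatrix, transpose_pow, transpose_permAverage]
    exact ((((rowSparse_permAverage _).pow t).submatrix ψ φ hφ).smul (a : ℂ)).mono (by simp)
  · have heq : (a : ℂ) • (permAverage σ ^ t).submatrix φ ψ -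
        of (fun _ _ => ((1 / √((k : ℝ) * l) : ℝ) : ℂ)) = (a : ℂ) •
        (permAverage σ ^ t -
          of fun _ _ => (Fintype.card (ZMod m × ZMod m) : ℂ)⁻¹).submatrix φ ψ := by
      rw [submatrix_sub, Pi.sub_apply, Pi.sub_apply, smul_sub]
      congr 1
      ext i j
      have : (1 / √((k : ℝ) * l) : ℝ) = a * ((m * m : ℕ) : ℝ)⁻¹ := by
        rw [ha]; field_simp
      rw [of_apply, this, Matrix.smul_apply, submatrix_apply, of_apply, hcard, smul_eq_mul]
      push_cast
      rfl
    rw [heq]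
    have hsub := sum_norm_submatrix_mulVec_sq_le (by positivity) hpow hφ hψ f
    have hnorm : ∀ x : ℂ, ‖(a : ℂ) * x‖ ^ 2 ≤ ‖x‖ ^ 2 := by
      intro x
      rw [norm_mul, Complex.norm_real, Real.norm_of_nonneg ha0]
      gcongr
      exact mul_le_of_le_one_left (norm_nonneg x) ha1
    calc _ ≤ _ := Finset.sum_le_sum fun i _ => by
            rw [smul_mulVec, Pi.smul_apply, smul_eq_mul]; exact hnorm _
      _ ≤ _ := hsub
      _ ≤ ε * ∑ j, ‖f j‖ ^ 2 := by
        gcongr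
        rw [lt_div_iff₀ hcpos] at ht
        linarith

/-! ### Block matrices and block diagonal operators -/

theorem Matrix.RowSparse.fromBlocks {m₁ m₂ n₁ n₂ R : Type*} [Zero R] {A : Matrix m₁ n₁ R}
    {B : Matrix m₁ n₂ R} {C : Matrix m₂ n₁ R} {D : Matrix m₂ n₂ R} {d e : ℕ} (hA : A.RowSparse d)
    (hB : B.RowSparse e) (hC : C.RowSparse e) (hD : D.RowSparse d) :
    (Matrix.fromBlocks A B C D).RowSparse (d + e) := by
  rintro (i | i)
  · obtain ⟨s, hs, hs'⟩ := hA i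
    obtain ⟨t, ht, ht'⟩ := hB i
    refine ⟨s.disjSum t, by rw [Finset.card_disjSum]; omega, ?_⟩
    rintro (j | j) hj
    · exact hs' j fun h => hj (Finset.inl_mem_disjSum.2 h)
    · exact ht' j fun h => hj (Finset.inr_mem_disjSum.2 h)
  · obtain ⟨s, hs, hs'⟩ := hC i
    obtain ⟨t, ht, ht'⟩ := hD i
    refine ⟨s.disjSum t, by rw [Finset.card_disjSum]; omega, ?_⟩
    rintro (j | j) hj
    · exact hs' j fun h => hj (Finset.inl_mem_disjSum.2 h)
    · exact ht' j fun h => hj (Finset.inr_mem_disjSum.2 h)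

theorem Matrix.RowSparse.neg {m n R : Type*} [SubtractionMonoid R] {A : Matrix m n R} {d : ℕ}
    (hA : A.RowSparse d) : (-A).RowSparse d := fun i =>
  let ⟨s, hs, hs'⟩ := hA i
  ⟨s, hs, fun j hj => by rw [Matrix.neg_apply, hs' j hj, neg_zero]⟩

theorem Matrix.sum_norm_fromBlocks_mulVec_sq_le {m n : Type*} [Fintype m] [Fintype n]
    {A : Matrix m n ℂ} {B : Matrix n m ℂ} {r : ℝ}
    (hA : ∀ f : n → ℂ, ∑ i, ‖(A.mulVec f) i‖ ^ 2 ≤ r * ∑ j, ‖f j‖ ^ 2)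
    (hB : ∀ f : m → ℂ, ∑ i, ‖(B.mulVec f) i‖ ^ 2 ≤ r * ∑ j, ‖f j‖ ^ 2) (f : m ⊕ n → ℂ) :
    ∑ i, ‖((Matrix.fromBlocks 0 A B 0).mulVec f) i‖ ^ 2 ≤ r * ∑ j, ‖f j‖ ^ 2 := by
  have h1 := hA (f ∘ Sum.inr)
  have h2 := hB (f ∘ Sum.inl)
  simp only [Matrix.fromBlocks_mulVec, Fintype.sum_sum_type, Sum.elim_inl, Sum.elim_inr,
    Matrix.zero_mulVec, zero_add, add_zero]
  simp only [Function.comp_apply] at h1 h2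
  linarith

/-- A family of square matrices with uniformly bounded operator norms defines a block diagonal
operator on `ℓ²`. -/
theorem lp.exists_blockDiagonal {ι : Type*} {W : ι → Type*} [∀ i, Fintype (W i)]
    (D : ∀ i, Matrix (W i) (W i) ℂ) {c : ℝ} (hc : 0 ≤ c)
    (hD : ∀ i (f : W i → ℂ), ∑ a, ‖((D i).mulVec f) a‖ ^ 2 ≤ c ^ 2 * ∑ a, ‖f a‖ ^ 2) :
    ∃ T : lp (fun _ : Σ i, W i => ℂ) 2 →L[ℂ] lp (fun _ : Σ i, W i => ℂ) 2, ‖T‖ ≤ c ∧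
      ∀ f v, T f v = ((D v.1).mulVec fun b => f ⟨v.1, b⟩) v.2 := by
  classical
  have hfin : ∀ (F : (Σ i, W i) → ℂ) (M : ℝ), (∀ s : Finset (Σ i, W i), ∑ v ∈ s, ‖F v‖ ^ 2 ≤ M) →
      ∀ s : Finset (Σ i, W i),
        ∑ v ∈ s, ‖((D v.1).mulVec fun b => F ⟨v.1, b⟩) v.2‖ ^ 2 ≤ c ^ 2 * M := by
    intro F M hF s
    -- Enlarge `s` to the union of all blocks it meets, so that the bound for each whole block
    -- applies.
    set I := s.image Sigma.fst with hI
    have hs : s ⊆ I.sigma fun _ => Finset.univ := fun v hv =>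
      Finset.mem_sigma.2 ⟨Finset.mem_image_of_mem _ hv, Finset.mem_univ _⟩
    calc ∑ v ∈ s, ‖((D v.1).mulVec fun b => F ⟨v.1, b⟩) v.2‖ ^ 2
        ≤ ∑ v ∈ I.sigma fun _ => Finset.univ, ‖((D v.1).mulVec fun b => F ⟨v.1, b⟩) v.2‖ ^ 2 :=
          Finset.sum_le_sum_of_subset_of_nonneg hs fun _ _ _ => by positivity
      _ ≤ ∑ i ∈ I, c ^ 2 * ∑ a, ‖F ⟨i, a⟩‖ ^ 2 := by
          rw [Finset.sum_sigma]
          exact Finset.sum_le_sum fun i _ => hD i fun b => F ⟨i, b⟩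
      _ = c ^ 2 * ∑ v ∈ I.sigma fun _ => Finset.univ, ‖F v‖ ^ 2 := by
          rw [← Finset.mul_sum, Finset.sum_sigma]
      _ ≤ c ^ 2 * M := by gcongr; exact hF _
  have key : ∀ (f : lp (fun _ : Σ i, W i => ℂ) 2) (s : Finset (Σ i, W i)),
      ∑ v ∈ s, ‖((D v.1).mulVec fun b => f ⟨v.1, b⟩) v.2‖ ^ 2 ≤ (c * ‖f‖) ^ 2 := by
    intro f s
    rw [mul_pow]
    refine hfin f (‖f‖ ^ 2) (fun s => ?_) s
    simpa using lp.sum_rpow_le_norm_rpow (p := 2) (by norm_num) f s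
  refine ⟨LinearMap.mkContinuous
    { toFun := fun f => ⟨fun v => ((D v.1).mulVec fun b => f ⟨v.1, b⟩) v.2,
        memℓp_gen' (C := (c * ‖f‖) ^ 2) fun s => by simpa using key f s⟩
      map_add' := fun f g => by
        ext v
        exact congrFun (Matrix.mulVec_add (D v.1) (fun b => f ⟨v.1, b⟩) fun b => g ⟨v.1, b⟩) v.2
      map_smul' := fun a f => by
        ext v
        exact congrFun (Matrix.mulVec_smul (D v.1) a fun b => f ⟨v.1, b⟩) v.2 } c fun f => ?_,
    LinearMap.mkContinuous_norm_le _ hc _, fun f v => rfl⟩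
  refine lp.norm_le_of_forall_sum_le (by norm_num) (by positivity) fun s => ?_
  simpa using key f s

/-! ### Matrix entries of operators on `ℓ²` -/

namespace SimpleGraph

section MatrixEntry

variable {V : Type*}

theorem matrixEntry_sub (S T : lp (fun _ : V => ℂ) 2 →L[ℂ] lp (fun _ : V => ℂ) 2) (v w : V) :
    matrixEntry (S - T) v w = matrixEntry S v w - matrixEntry T v w := rfl

open Classical in
theorem matrixEntry_normLaplacian (G : SimpleGraph V) [G.LocallyFinite] (v w : V) :
    matrixEntry G.normLaplacian v w = (if v = w then 1 else 0) -
      if G.Adj v w then ((1 / √((G.degree v : ℝ) * (G.degree w : ℝ)) : ℝ) : ℂ) else 0 := by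
  unfold matrixEntry
  rw [normLaplacian_apply]
  simp [lp.single_apply, Pi.single_apply]

open Classical in
theorem map_sum_single_apply (T : lp (fun _ : V => ℂ) 2 →L[ℂ] lp (fun _ : V => ℂ) 2)
    (s : Finset V) (v : V) :
    T (∑ w ∈ s, lp.single 2 w (1 : ℂ)) v = ∑ w ∈ s, matrixEntry T v w := by
  rw [map_sum, lp.coeFn_sum, Finset.sum_apply]
  rfl

/-- The mass in `t` of the image of the indicator function of `s` is bounded by the operator norm. -/
theorem sum_norm_sum_matrixEntry_sq_le (T : lp (fun _ : V => ℂ) 2 →L[ℂ] lp (fun _ : V => ℂ) 2)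
    (s t : Finset V) :
    ∑ v ∈ t, ‖∑ w ∈ s, matrixEntry T v w‖ ^ 2 ≤ ‖T‖ ^ 2 * s.card := by
  classical
  set f : lp (fun _ : V => ℂ) 2 := ∑ w ∈ s, lp.single 2 w (1 : ℂ) with hf
  have h1 : ‖f‖ ^ 2 = s.card := by
    have := lp.norm_sum_single (E := fun _ : V => ℂ) (p := 2) (by norm_num) (fun _ => (1 : ℂ)) s
    simpa using this
  have h2 : ∑ v ∈ t, ‖T f v‖ ^ 2 ≤ ‖T f‖ ^ 2 := by
    simpa using lp.sum_rpow_le_norm_rpow (p := 2) (by norm_num) (T f) t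
  have h3 : ∀ v, T f v = ∑ w ∈ s, matrixEntry T v w := by
    intro v
    rw [← map_sum_single_apply, hf]
  simp only [h3] at h2
  calc _ ≤ ‖T f‖ ^ 2 := h2
    _ ≤ (‖T‖ * ‖f‖) ^ 2 := by gcongr; exact T.le_opNorm f
    _ = _ := by rw [mul_pow, h1]

theorem matrixEntry_blockDiagonal {ι : Type*} {W : ι → Type*} [∀ i, Fintype (W i)]
    {D : ∀ i, Matrix (W i) (W i) ℂ}
    {T : lp (fun _ : Σ i, W i => ℂ) 2 →L[ℂ] lp (fun _ : Σ i, W i => ℂ) 2}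
    (hT : ∀ f v, T f v = ((D v.1).mulVec fun b => f ⟨v.1, b⟩) v.2) :
    (∀ i a b, matrixEntry T ⟨i, a⟩ ⟨i, b⟩ = D i a b) ∧
      ∀ v w : Σ i, W i, v.1 ≠ w.1 → matrixEntry T v w = 0 := by
  classical
  unfold matrixEntry
  constructor
  · intro i a b
    rw [hT]
    simp [Matrix.mulVec, dotProduct, lp.single_apply, Pi.single_apply]
  · intro v w h
    rw [hT]
    refine Finset.sum_eq_zero fun b _ => ?_
    have hne : (⟨v.1, b⟩ : Σ i, W i) ≠ w := by
      rintro rfl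
      exact h rfl
    simp [lp.single_apply, hne]

/-- Rows and columns of a block diagonal operator meet only their own block, so a bound uniform over
the blocks suffices. -/
theorem mem_sparseOperators_of_rowSparse {ι : Type*} {W : ι → Type*} {K : ∀ i, Matrix (W i) (W i) ℂ}
    {T : lp (fun _ : Σ i, W i => ℂ) 2 →L[ℂ] lp (fun _ : Σ i, W i => ℂ) 2} {d : ℕ}
    (hT : ∀ i a b, matrixEntry T ⟨i, a⟩ ⟨i, b⟩ = K i a b)
    (hT' : ∀ v w : Σ i, W i, v.1 ≠ w.1 → matrixEntry T v w = 0)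
    (hK : ∀ i, (K i).RowSparse d) (hK' : ∀ i, (K i).transpose.RowSparse d) :
    T ∈ sparseOperators (Σ i, W i) d := by
  classical
  have key : ∀ (i : ι) (s : Finset (W i)) (p : (Σ i, W i) → Prop), s.card ≤ d →
      (∀ w, w.1 ≠ i → ¬ p w) → (∀ b ∉ s, ¬ p ⟨i, b⟩) → {w | p w}.encard ≤ d := by
    intro i s p hs h1 h2
    have hsub : {w | p w} ⊆ ((s.image (Sigma.mk i) : Finset (Σ i, W i)) : Set (Σ i, W i)) := by
      rintro ⟨j, b⟩ hw
      by_cases hj : j = i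
      · subst hj
        have hb : b ∈ s := by
          by_contra hb
          exact h2 b hb hw
        simpa using hb
      · exact absurd hw (h1 _ hj)
    refine (Set.encard_le_encard hsub).trans ?_
    rw [Set.encard_coe_eq_coe_finsetCard]
    exact_mod_cast Finset.card_image_le.trans hs
  constructor
  · rintro ⟨i, a⟩
    obtain ⟨s, hs, hs'⟩ := hK i a
    refine key i s _ hs (fun w hw h => h (hT' _ _ hw.symm)) fun b hb h => h ?_
    rw [hT, hs' b hb]
  · rintro ⟨i, a⟩
    obtain ⟨s, hs, hs'⟩ := hK' i a
    refine key i s _ hs (fun w hw h => h (hT' _ _ hw)) fun b hb h => h ?_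
    rw [hT]
    exact hs' b hb

end MatrixEntry

/-! ### Disjoint unions of complete bipartite graphs -/

section DisjointUnion

variable {ι : Type*} {W : ι → Type*}

theorem disjointUnion_adj_mk (H : ∀ i, SimpleGraph (W i)) (i : ι) (a b : W i) :
    (disjointUnion H).Adj ⟨i, a⟩ ⟨i, b⟩ ↔ (H i).Adj a b := by
  constructor
  · rintro ⟨j, x, y, hx, hy, h⟩
    obtain ⟨rfl, hx⟩ := Sigma.mk.inj_iff.1 hx
    obtain ⟨-, hy⟩ := Sigma.mk.inj_iff.1 hy
    rwa [eq_of_heq hx, eq_of_heq hy]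
  · exact fun h => ⟨i, a, b, rfl, rfl, h⟩

theorem fst_eq_of_disjointUnion_adj {H : ∀ i, SimpleGraph (W i)} {v w : Σ i, W i}
    (h : (disjointUnion H).Adj v w) : v.1 = w.1 := by
  obtain ⟨i, a, b, rfl, rfl, -⟩ := h
  rfl

theorem degree_disjointUnion [∀ i, Finite (W i)] (H : ∀ i, SimpleGraph (W i)) (i : ι) (a : W i)
    [Fintype ((H i).neighborSet a)] :
    (disjointUnion H).degree ⟨i, a⟩ = (H i).degree a := by
  rw [← card_neighborFinset_eq_degree, ← card_neighborFinset_eq_degree]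
  rw [← Finset.card_map ⟨Sigma.mk i, sigma_mk_injective⟩]
  congr 1
  ext ⟨j, b⟩
  simp only [mem_neighborFinset, Finset.mem_map, Function.Embedding.coeFn_mk]
  constructor
  · intro h
    have hij : i = j := fst_eq_of_disjointUnion_adj h
    subst hij
    exact ⟨b, (disjointUnion_adj_mk H i a b).1 h, rfl⟩
  · rintro ⟨c, hc, he⟩
    rw [← he]
    exact (disjointUnion_adj_mk H i a c).2 hc

variable (k l : ℕ → ℕ)

theorem degree_disjointUnion_completeBipartiteGraph_inl (n : ℕ) (a : Fin (k n)) :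
    (disjointUnion fun n => completeBipartiteGraph (Fin (k n)) (Fin (l n))).degree
      ⟨n, Sum.inl a⟩ = l n := by
  classical
  rw [degree_disjointUnion, ← card_neighborFinset_eq_degree]
  have : (completeBipartiteGraph (Fin (k n)) (Fin (l n))).neighborFinset (Sum.inl a) =
      Finset.univ.map Function.Embedding.inr := by
    ext (b | b) <;> simp
  rw [this, Finset.card_map, Finset.card_univ, Fintype.card_fin]

theorem degree_disjointUnion_completeBipartiteGraph_inr (n : ℕ) (b : Fin (l n)) :
    (disjointUnion fun n => completeBipartiteGraph (Fin (k n)) (Fin (l n))).degree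
      ⟨n, Sum.inr b⟩ = k n := by
  classical
  rw [degree_disjointUnion, ← card_neighborFinset_eq_degree]
  have : (completeBipartiteGraph (Fin (k n)) (Fin (l n))).neighborFinset (Sum.inr b) =
      Finset.univ.map Function.Embedding.inl := by
    ext (b | b) <;> simp
  rw [this, Finset.card_map, Finset.card_univ, Fintype.card_fin]

theorem matrixEntry_normLaplacian_completeBipartite (n : ℕ) (a b : Fin (k n) ⊕ Fin (l n)) :
    matrixEntry
      (disjointUnion fun n => completeBipartiteGraph (Fin (k n)) (Fin (l n))).normLaplacian
      ⟨n, a⟩ ⟨n, b⟩ = Matrix.fromBlocks 1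
        (-Matrix.of fun _ _ => ((1 / √((k n : ℝ) * l n) : ℝ) : ℂ))
        (-Matrix.of fun _ _ => ((1 / √((l n : ℝ) * k n) : ℝ) : ℂ)) 1 a b := by
  rw [matrixEntry_normLaplacian, disjointUnion_adj_mk]
  rcases a with a | a <;> rcases b with b | b <;>
    simp [degree_disjointUnion_completeBipartiteGraph_inl,
      degree_disjointUnion_completeBipartiteGraph_inr, Matrix.one_apply, mul_comm]

theorem matrixEntry_normLaplacian_disjointUnion_eq_zero [∀ i, Finite (W i)]
    (H : ∀ i, SimpleGraph (W i)) {v w : Σ i, W i} (h : v.1 ≠ w.1) :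
    matrixEntry (disjointUnion H).normLaplacian v w = 0 := by
  rw [matrixEntry_normLaplacian, if_neg fun he => h (congrArg Sigma.fst he),
    if_neg fun he => h (fst_eq_of_disjointUnion_adj he), sub_zero]

theorem isAULF_completeBipartite_of_bounded (hk : ∀ n, 0 < k n) (hkl : ∀ n, k n ≤ l n) {C : ℝ}
    (hC : ∀ n, (l n : ℝ) / (k n : ℝ) ≤ C) :
    (disjointUnion fun n => completeBipartiteGraph (Fin (k n)) (Fin (l n))).IsAULF := by
  rw [IsAULF, Metric.mem_closure_iff]
  intro ε hε
  obtain ⟨d, hd⟩ := exists_rowSparse_approx (max C 1) (ε := (ε / 2) ^ 2) (by positivity)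
  have hkpos : ∀ n, (0 : ℝ) < k n := fun n => by exact_mod_cast hk n
  have hle : ∀ n, (k n : ℝ) ≤ l n := fun n => by exact_mod_cast hkl n
  have hkC : ∀ n, (k n : ℝ) ≤ max C 1 * l n := fun n => (hle n).trans
    (le_mul_of_one_le_left (Nat.cast_nonneg _) (le_max_right _ _))
  have hlC : ∀ n, (l n : ℝ) ≤ max C 1 * k n := fun n =>
    ((div_le_iff₀ (hkpos n)).1 (hC n)).trans (by gcongr; exact le_max_left _ _)
  choose B hB hB' hBJ using fun n =>
    hd (k n) (l n) (hk n) ((hk n).trans_le (hkl n)) (hkC n) (hlC n)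
  choose B₂ hB₂ hB₂' hBJ₂ using fun n =>
    hd (l n) (k n) ((hk n).trans_le (hkl n)) (hk n) (hlC n) (hkC n)
  -- `D` is the error, not the approximant. The two off-diagonal blocks are approximated
  -- independently, by the same result with `k` and `l` exchanged, so no norm bound for a transpose
  -- is needed.
  let D : ∀ n, Matrix (Fin (k n) ⊕ Fin (l n)) (Fin (k n) ⊕ Fin (l n)) ℂ := fun n =>
    Matrix.fromBlocks 0
      (B n - Matrix.of fun _ _ => ((1 / √((k n : ℝ) * l n) : ℝ) : ℂ))
      (B₂ n - Matrix.of fun _ _ => ((1 / √((l n : ℝ) * k n) : ℝ) : ℂ)) 0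
  obtain ⟨S, hS, hSD⟩ := lp.exists_blockDiagonal D (c := ε / 2) (by positivity)
    (fun n f => Matrix.sum_norm_fromBlocks_mulVec_sq_le (hBJ n) (hBJ₂ n) f)
  obtain ⟨hS₁, hS₂⟩ := matrixEntry_blockDiagonal (D := D) hSD
  set L := (disjointUnion fun n => completeBipartiteGraph (Fin (k n)) (Fin (l n))).normLaplacian
    with hL
  -- Taking the approximant to be `L - S` makes it bounded automatically; only its entries must be
  -- computed. The `1` in `1 + d` counts the diagonal entry.
  refine ⟨L - S, Set.mem_iUnion.2 ⟨1 + d, ?_⟩, ?_⟩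
  · refine mem_sparseOperators_of_rowSparse
      (K := fun n => Matrix.fromBlocks 1 (-B n) (-B₂ n) 1) ?_ ?_ ?_ ?_
    · intro n a b
      rw [matrixEntry_sub, hS₁, hL, matrixEntry_normLaplacian_completeBipartite]
      rcases a with a | a <;> rcases b with b | b <;> simp [D] <;> ring
    · intro v w h
      rw [matrixEntry_sub, hS₂ v w h, hL, matrixEntry_normLaplacian_disjointUnion_eq_zero _ h,
        sub_zero]
    · exact fun n => .fromBlocks Matrix.rowSparse_one (hB n).neg (hB₂ n).neg Matrix.rowSparse_one
    · intro n
      rw [Matrix.fromBlocks_transpose, Matrix.transpose_one, Matrix.transpose_one,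
        Matrix.transpose_neg, Matrix.transpose_neg]
      exact .fromBlocks Matrix.rowSparse_one (hB₂' n).neg (hB' n).neg Matrix.rowSparse_one
  · rw [dist_eq_norm, sub_sub_cancel]
    linarith

theorem bounded_of_isAULF_completeBipartite (hk : ∀ n, 0 < k n) (hkl : ∀ n, k n ≤ l n)
    (h : (disjointUnion fun n => completeBipartiteGraph (Fin (k n)) (Fin (l n))).IsAULF) :
    ∃ C : ℝ, ∀ n, (l n : ℝ) / (k n : ℝ) ≤ C := by
  classical
  rw [IsAULF, Metric.mem_closure_iff] at h
  obtain ⟨T, hT, hLT⟩ := h (1 / 2) (by norm_num)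
  obtain ⟨d, hd⟩ := Set.mem_iUnion.1 hT
  refine ⟨2 * d, fun n => ?_⟩
  by_contra! hn
  have hkpos : (0 : ℝ) < k n := by exact_mod_cast hk n
  have hlpos : (0 : ℝ) < l n := by exact_mod_cast (hk n).trans_le (hkl n)
  rw [lt_div_iff₀ hkpos] at hn
  set N : Fin (k n) → Finset (Fin (l n)) := fun a => Finset.univ.filter fun b =>
    matrixEntry T ⟨n, Sum.inl a⟩ ⟨n, Sum.inr b⟩ ≠ 0 with hN
  let e : Fin (l n) ↪ Σ n, Fin (k n) ⊕ Fin (l n) :=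
    ⟨fun b => ⟨n, Sum.inr b⟩, sigma_mk_injective.comp Sum.inr_injective⟩
  let e' : Fin (k n) ↪ Σ n, Fin (k n) ⊕ Fin (l n) :=
    ⟨fun a => ⟨n, Sum.inl a⟩, sigma_mk_injective.comp Sum.inl_injective⟩
  have hNd : ∀ a, (N a).card ≤ d := by
    intro a
    have hsub : (((N a).map e : Finset _) : Set _) ⊆
        {w | matrixEntry T ⟨n, Sum.inl a⟩ w ≠ 0} := by
      intro w hw
      obtain ⟨b, hb, rfl⟩ := Finset.mem_map.1 (Finset.mem_coe.1 hw)
      exact (Finset.mem_filter.1 hb).2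
    have := (Set.encard_le_encard hsub).trans (hd.1 ⟨n, Sum.inl a⟩)
    rw [Set.encard_coe_eq_coe_finsetCard, Finset.card_map] at this
    exact_mod_cast this
  -- `S` consists of the columns where all `k n` rows of `T` vanish. It has at least `l n - k n * d`
  -- elements, more than `l n / 2` since `l n > 2 * d * k n`.
  set S : Finset (Fin (l n)) := (Finset.univ.biUnion N)ᶜ with hS
  have hScard : (l n : ℝ) ≤ S.card + k n * d := by
    have h1 : (Finset.univ.biUnion N).card ≤ k n * d := by
      simpa using Finset.card_biUnion_le_card_mul Finset.univ N d fun a _ => hNd a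
    have h2 := Finset.card_add_card_compl (Finset.univ.biUnion N)
    rw [Fintype.card_fin, ← hS] at h2
    have : l n ≤ S.card + k n * d := by omega
    exact_mod_cast this
  set L := (disjointUnion fun n => completeBipartiteGraph (Fin (k n)) (Fin (l n))).normLaplacian
    with hL
  have hentry : ∀ a, ∀ b ∈ S, matrixEntry (L - T) ⟨n, Sum.inl a⟩ ⟨n, Sum.inr b⟩ =
      ((-(1 / √((k n : ℝ) * l n)) : ℝ) : ℂ) := by
    intro a b hb
    have h0 : matrixEntry T ⟨n, Sum.inl a⟩ ⟨n, Sum.inr b⟩ = 0 := by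
      by_contra h0
      refine Finset.mem_compl.1 hb (Finset.mem_biUnion.2 ⟨a, Finset.mem_univ _, ?_⟩)
      exact Finset.mem_filter.2 ⟨Finset.mem_univ _, h0⟩
    rw [matrixEntry_sub, h0, sub_zero, hL, matrixEntry_normLaplacian_completeBipartite,
      Matrix.fromBlocks_apply₁₂, Matrix.neg_apply, Matrix.of_apply, Complex.ofReal_neg]
  -- Test `L - T` on the indicator function of `S`: on these entries it agrees with the constant
  -- block of `L`, so the mass of the image is at least `S.card ^ 2 / l n`.
  have main := sum_norm_sum_matrixEntry_sq_le (L - T) (S.map e) (Finset.univ.map e')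
  simp only [Finset.sum_map, Finset.card_map] at main
  have hrow : ∀ a, ‖∑ b ∈ S, matrixEntry (L - T) (e' a) (e b)‖ ^ 2 =
      (S.card : ℝ) ^ 2 / (k n * l n) := by
    intro a
    have hsum : ∑ b ∈ S, matrixEntry (L - T) (e' a) (e b) =
        ∑ _b ∈ S, ((-(1 / √((k n : ℝ) * l n)) : ℝ) : ℂ) := Finset.sum_congr rfl (hentry a)
    rw [hsum, Finset.sum_const, nsmul_eq_mul, norm_mul,
      Complex.norm_real, norm_neg, Complex.norm_natCast, Real.norm_of_nonneg (by positivity),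
      mul_pow, div_pow, Real.sq_sqrt (by positivity)]
    ring
  simp only [hrow, Finset.sum_const, Finset.card_univ, Fintype.card_fin, nsmul_eq_mul] at main
  rw [dist_eq_norm] at hLT
  have hsq : ‖L - T‖ ^ 2 ≤ 1 / 4 := by nlinarith [norm_nonneg (L - T)]
  have hSpos : (0 : ℝ) < S.card := by linarith
  have hfin : (S.card : ℝ) ^ 2 / l n ≤ 1 / 4 * S.card := by
    calc (S.card : ℝ) ^ 2 / l n = k n * ((S.card : ℝ) ^ 2 / (k n * l n)) := by field_simp
      _ ≤ ‖L - T‖ ^ 2 * S.card := main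
      _ ≤ _ := by gcongr
  rw [div_le_iff₀ hlpos] at hfin
  -- The norm bound gives `S.card ≤ l n / 4`, against `S.card > l n / 2`.
  nlinarith

end DisjointUnion

end SimpleGraph

/-- The disjoint union of the complete bipartite graphs `K_{k n, l n}`, with `0 < k n ≤ l n`, is
approximately uniformly locally finite if and only if the ratios `l n / k n` are bounded. -/
theorem proposition2p2 (k l : ℕ → ℕ) (hk : ∀ n, 0 < k n) (hkl : ∀ n, k n ≤ l n) :
    (SimpleGraph.disjointUnion fun n =>
        completeBipartiteGraph (Fin (k n)) (Fin (l n))).IsAULF ↔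
      ∃ C : ℝ, ∀ n, (l n : ℝ) / (k n : ℝ) ≤ C :=
  ⟨SimpleGraph.bounded_of_isAULF_completeBipartite k l hk hkl,
    fun ⟨_, hC⟩ => SimpleGraph.isAULF_completeBipartite_of_bounded k l hk hkl hC⟩
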